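/- Let $\sigma$ be a relational vocabulary (a set of relation symbols, each of positive finite arity) and let $k\ge 1$. Let $\mathcal R(\sigma)$ be the category of $\sigma$-structures and homomorphisms. The pebbling comonad $\mathbb P_k$ on $\mathcal R(\sigma)$ sends $\mathscr A$ to the structure on $(\{1,\dots,k\}\times A)^{+}$ (finite non-empty sequences of moves $(p,a)$) in which, for $R\in\sigma$ of arity $n$, $R^{\mathbb P_k\mathscr A}(s_1,\dots,s_n)$ holds iff the $s_i$ are pairwise comparable in the prefix order, whenever $s_j=s_iw$ the pebble index of the last move of $s_i$ does not occur in $w$, and $R^{\mathscr A}(\varepsilon(s_1),\dots,\varepsilon(s_n))$, where the counit $\varepsilon$ sends $[(p_1,a_1),\dots,(p_m,a_m)]$ to $a_m$. The coextension of $f:\mathbb P_k\mathscr A\to\mathscr B$ is $f^{*}[(p_1,a_1),\dots,(p_m,a_m)]=[(p_1,b_1),\dots,(p_m,b_m)]$ with $b_i=f[(p_1,a_1),\dots,(p_i,a_i)]$; coKleisli morphisms $\mathscr A\to\mathscr B$ are homomorphisms $\mathbb P_k\mathscr A\to\mathscr B$, with composition $g\bullet f=g\circ f^{*}$ and identities $\varepsilon$.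 Let $\sigma^{+}=\sigma\cup\{I\}$ with $I$ a new binary symbol, and let $J:\mathcal R(\sigma)\to\mathcal R(\sigma^{+})$ interpret $I$ as equality. The coKleisli category of the relative comonad $\mathbb P_k^{+}$ has the $\sigma$-structures as objects, the homomorphisms $\mathbb P_k J\mathscr A\to J\mathscr B$ of $\sigma^{+}$-structures as morphisms $\mathscr A\to\mathscr B$, and the same identities and composition, with $\mathbb P_k$ taken over $\sigma^+$. Let $\mathcal L^{k}(\#)$ be the logic whose formulas are built from atomic formulas (equalities included) in the variables $x_1,\dots,x_k$ by negation, conjunctions and disjunctions of arbitrary set-indexed families, and the quantifiers $\exists x_i$, $\forall x_i$, $\exists_{\ge n}x_i$, $\exists_{\le n}x_i$ $(n\in\mathbb N)$. Let $\exists\mathcal L^{k}$ be its existential-positive fragment, whose formulas are built from atomic formulas by (infinitary) conjunction and disjunction and $\exists x_i$ only. For a logic $\mathcal L$, write $\mathscr A\equiv^{\mathcal L}\mathscr B$ if $\mathscr A$ and $\mathscr B$ satisfy the same sentences of $\mathcal L$. 1. For all $\sigma$-structures $\mathscr A$ and $\mathscr B$: $\mathscr A\equiv^{\exists\mathcal L^{k}}\mathscr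 B$ if and only if there are coKleisli morphisms $\mathbb P_k\mathscr A\to\mathscr B$ and $\mathbb P_k\mathscr B\to\mathscr A$; and likewise $\mathscr A\equiv^{\exists\mathcal L^{k}}\mathscr B$ if and only if there are morphisms $\mathscr A\to\mathscr B$ and $\mathscr B\to\mathscr A$ in the coKleisli category of $\mathbb P_k^{+}$. 2. For all finite $\sigma$-structures $\mathscr A$ and $\mathscr B$: $\mathscr A\equiv^{\mathcal L^{k}(\#)}\mathscr B$ if and only if $\mathscr A$ and $\mathscr B$ are isomorphic in the coKleisli category of $\mathbb P_k^{+}$. -/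

import Mathlib

open CategoryTheory

universe u

/-! ### Relational structures and the category `R(σ)` -/

/-- An object of the category `R(σ)`: a set together with an interpretation of every relation
symbol of `σ`. -/
structure RelStr (σ : FirstOrder.Language.{u, u}) where
  carrier : Type u
  [str : σ.Structure carrier]

namespace RelStr

instance (σ : FirstOrder.Language.{u, u}) : CoeSort (RelStr σ) (Type u) := ⟨carrier⟩

instance instStr {σ : FirstOrder.Language.{u, u}} (A : RelStr σ) : σ.Structure A := A.str

/-- `R(σ)`: the morphisms are the homomorphisms of `σ`-structures. -/
instance (σ : FirstOrder.Language.{u, u}) : Category (RelStr σ) where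
  Hom A B := FirstOrder.Language.Hom σ A B
  id A := FirstOrder.Language.Hom.id σ A
  comp f g := FirstOrder.Language.Hom.comp g f

/-- The underlying function of a homomorphism. -/
def fn {σ : FirstOrder.Language.{u, u}} {A B : RelStr σ} (f : A ⟶ B) : A → B :=
  FirstOrder.Language.Hom.toFun f

theorem fn_inj {σ : FirstOrder.Language.{u, u}} {A B : RelStr σ} {f g : A ⟶ B} (h : fn f = fn g) :
    f = g :=
  FirstOrder.Language.Hom.ext (fun x => congrFun h x)

theorem fn_rel {σ : FirstOrder.Language.{u, u}} {A B : RelStr σ} (f : A ⟶ B) {n : ℕ} (R : σ.Relations n)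
    (x : Fin n → A) (h : FirstOrder.Language.Structure.RelMap R x) :
    FirstOrder.Language.Structure.RelMap R (fn f ∘ x) :=
  FirstOrder.Language.Hom.map_rel' f R x h

@[simp] theorem fn_id {σ : FirstOrder.Language.{u, u}} (A : RelStr σ) : fn (𝟙 A) = id := rfl

@[simp] theorem fn_comp {σ : FirstOrder.Language.{u, u}} {A B C : RelStr σ} (f : A ⟶ B) (g : B ⟶ C) :
    fn (f ≫ g) = fn g ∘ fn f := rfl

/-- A relation-preserving map is a homomorphism, as `σ` has no function symbols. -/
def homMk {σ : FirstOrder.Language.{u, u}} [σ.IsRelational] {A B : RelStr σ} (f : A → B)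
    (h : ∀ {n : ℕ} (R : σ.Relations n) (x : Fin n → A),
      FirstOrder.Language.Structure.RelMap R x → FirstOrder.Language.Structure.RelMap R (f ∘ x)) : A ⟶ B :=
  ({ toFun := f, map_fun' := fun F => isEmptyElim F, map_rel' := h } : FirstOrder.Language.Hom σ A B)

@[simp] theorem fn_homMk {σ : FirstOrder.Language.{u, u}} [σ.IsRelational] {A B : RelStr σ} (f : A → B)
    (h : ∀ {n : ℕ} (R : σ.Relations n) (x : Fin n → A),
      FirstOrder.Language.Structure.RelMap R x → FirstOrder.Language.Structure.RelMap R (f ∘ x)) :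
    fn (homMk f h) = f := rfl

end RelStr

/-! ### The pebbling comonad -/

/-- Finite non-empty sequences of moves `(p, a)`, with `p` one of `k` pebbles and `a ∈ A`. -/
abbrev Plays (k : ℕ) (A : Type u) : Type u := {l : List (Fin k × A) // l ≠ []}

namespace Plays

variable {k : ℕ} {A B C : Type u}

/-- The last move of a play. -/
def lastMove (s : Plays k A) : Fin k × A := s.1.getLast s.2

/-- The element on which the last move places its pebble. -/
def counit (s : Plays k A) : A := s.lastMove.2

/-- The coextension `[(p₁,a₁),…,(pⱼ,aⱼ)] ↦ [(p₁,b₁),…,(pⱼ,bⱼ)]`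
with `bᵢ = f [(p₁,a₁),…,(pᵢ,aᵢ)]`. -/
def coext (f : Plays k A → B) (s : Plays k A) : Plays k B :=
  ⟨s.1.mapFinIdx fun i m hi =>
      (m.1, f ⟨s.1.take (i + 1), by simpa using s.2⟩), by simpa using s.2⟩

theorem length_coext (f : Plays k A → B) (s : Plays k A) :
    (coext f s).1.length = s.1.length := by
  simp [coext]

theorem coext_counit (s : Plays k A) : coext counit s = s := by
  apply Subtype.ext
  apply List.ext_getElem
  · simp [coext]
  · intro i h1 h2
    simp [coext, counit, lastMove, List.getLast_eq_getElem]
    have : min (i + 1) s.1.length - 1 = i := by omega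
    simp [this]

theorem lastMove_coext (f : Plays k A → B) (s : Plays k A) :
    (coext f s).lastMove = (s.lastMove.1, f s) := by
  have h : s.1.length ≠ 0 := by simpa using s.2
  have e : s.1.length - 1 + 1 = s.1.length := by omega
  simp [coext, lastMove, List.getLast_eq_getElem, e]

theorem counit_coext (f : Plays k A → B) (s : Plays k A) : counit (coext f s) = f s := by
  simp [counit, lastMove_coext]

theorem coext_take (f : Plays k A → B) (s : Plays k A) (i : ℕ) (h : s.1.take i ≠ [])
    (h' : (coext f s).1.take i ≠ []) :
    (⟨(coext f s).1.take i, h'⟩ : Plays k B) = coext f ⟨s.1.take i, h⟩ := by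
  apply Subtype.ext
  apply List.ext_getElem
  · simp [coext]
  · intro j h1 h2
    have hj : j + 1 ≤ i := by
      simp at h1
      omega
    simp [coext, List.take_take, hj]

theorem coext_coext (f : Plays k A → B) (g : Plays k B → C) (s : Plays k A) :
    coext (g ∘ coext f) s = coext g (coext f s) := by
  apply Subtype.ext
  apply List.ext_getElem
  · simp [coext]
  · intro i h1 h2
    have hi : i < s.1.length := by simpa [length_coext] using h1
    have hne : s.1.take (i + 1) ≠ [] := by simpa using s.2
    have hne' : (coext f s).1.take (i + 1) ≠ [] := by simpa using (coext f s).2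
    have := coext_take f s (i + 1) hne hne'
    have e : (coext g (coext f s)).1[i] =
        (((coext f s).1[i]'(by simpa [length_coext] using hi)).1,
          g ⟨(coext f s).1.take (i + 1), hne'⟩) := by
      simp [coext]
    rw [e, this]
    have e' : (coext (g ∘ coext f) s).1[i] =
        ((s.1[i]'hi).1, (g ∘ coext f) ⟨s.1.take (i + 1), hne⟩) := by
      simp only [coext, List.getElem_mapFinIdx]
    rw [e', Function.comp_apply]
    congr 1
    simp [coext]

theorem coext_prefix (f : Plays k A → B) {s t : Plays k A} (h : s.1 <+: t.1) :
    (coext f s).1 <+: (coext f t).1 := by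
  have e : s.1 = t.1.take s.1.length := List.prefix_iff_eq_take.mp h
  have e' : s = ⟨t.1.take s.1.length, e ▸ s.2⟩ := Subtype.ext e
  have hne' : (coext f t).1.take s.1.length ≠ [] := by
    intro h0
    rcases List.take_eq_nil_iff.mp h0 with h1 | h1
    · exact s.2 (List.length_eq_zero_iff.mp h1)
    · exact (coext f t).2 h1
  have := coext_take f t s.1.length (e ▸ s.2) hne'
  rw [e', ← this]
  exact List.take_prefix _ _

/-- Pebble indices are not changed by coextension. -/
theorem map_fst_coext (f : Plays k A → B) (s : Plays k A) :
    (coext f s).1.map Prod.fst = s.1.map Prod.fst := by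
  apply List.ext_getElem
  · simp [coext]
  · intro i h1 h2
    simp [coext]

end Plays

/-- The conditions (1) and (2) in the interpretation of relation symbols on plays: the plays
`sᵢ` are pairwise comparable in the prefix order, and whenever `sⱼ = sᵢ w`, the pebble of the last
move of `sᵢ` does not occur in `w`. -/
def Plays.Current {k : ℕ} {A : Type u} {n : ℕ} (s : Fin n → Plays k A) : Prop :=
  (∀ i j, (s i).1 <+: (s j).1 ∨ (s j).1 <+: (s i).1) ∧
  (∀ i j w, (s j).1 = (s i).1 ++ w → ∀ m ∈ w, m.1 ≠ (s i).lastMove.1)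

theorem Plays.Current.coext {k : ℕ} {A B : Type u} {n : ℕ} {s : Fin n → Plays k A}
    (h : Plays.Current s) (f : Plays k A → B) : Plays.Current (Plays.coext f ∘ s) := by
  refine ⟨fun i j => (h.1 i j).imp (Plays.coext_prefix f) (Plays.coext_prefix f), ?_⟩
  intro i j w hw m hm
  have hlen := congrArg List.length hw
  simp only [Function.comp, List.length_append, Plays.length_coext] at hlen
  have hp : (s i).1 <+: (s j).1 := by
    rcases h.1 i j with h1 | h1
    · exact h1
    · rw [h1.eq_of_length_le (by omega)]
  obtain ⟨w', hw'⟩ := hp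
  have hmap := congrArg (List.map Prod.fst) hw
  simp only [Function.comp, List.map_append, Plays.map_fst_coext] at hmap
  rw [← hw', List.map_append] at hmap
  have hww := List.append_cancel_left hmap
  have hm' : m.1 ∈ w'.map Prod.fst := by
    rw [hww]
    exact List.mem_map_of_mem hm
  obtain ⟨m', hm1, hm2⟩ := List.mem_map.mp hm'
  have := h.2 i j w' hw'.symm m' hm1
  simp only [Function.comp, Plays.lastMove_coext]
  rw [← hm2]
  exact this

section Comonad

variable (σ : FirstOrder.Language.{u, u}) [σ.IsRelational] (k : ℕ)

/-- The structure `P_k A`. -/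
def pebbleObj (A : RelStr σ) : RelStr σ where
  carrier := Plays k A
  str :=
    { funMap := fun F => isEmptyElim F
      RelMap := fun R s =>
        Plays.Current s ∧ FirstOrder.Language.Structure.RelMap R (fun i => (s i).counit) }

variable {σ k}

/-- The counit `ε_A : P_k A ⟶ A`. -/
def pebbleCounit (A : RelStr σ) : pebbleObj σ k A ⟶ A :=
  RelStr.homMk Plays.counit fun _ _ h => h.2

/-- The coextension `f^* : P_k A ⟶ P_k B` of `f : P_k A ⟶ B`. -/
def pebbleCoext {A B : RelStr σ} (f : pebbleObj σ k A ⟶ B) :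
    pebbleObj σ k A ⟶ pebbleObj σ k B :=
  RelStr.homMk (Plays.coext (RelStr.fn f)) fun R s h => by
    refine ⟨h.1.coext _, ?_⟩
    have e : (fun i => Plays.counit ((Plays.coext (RelStr.fn f) ∘ s) i)) = RelStr.fn f ∘ s :=
      funext fun i => Plays.counit_coext (RelStr.fn f) (s i)
    exact e ▸ RelStr.fn_rel f R s h

theorem pebbleCoext_counit (A : RelStr σ) :
    pebbleCoext (pebbleCounit (k := k) A) = 𝟙 _ :=
  RelStr.fn_inj (funext Plays.coext_counit)

theorem pebbleCoext_comp_counit {A B : RelStr σ} (f : pebbleObj σ k A ⟶ B) :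
    pebbleCoext f ≫ pebbleCounit B = f :=
  RelStr.fn_inj (funext (Plays.counit_coext _))

theorem pebbleCoext_comp {A B C : RelStr σ} (f : pebbleObj σ k A ⟶ B)
    (g : pebbleObj σ k B ⟶ C) :
    pebbleCoext (pebbleCoext f ≫ g) = pebbleCoext f ≫ pebbleCoext g :=
  RelStr.fn_inj (funext (Plays.coext_coext (RelStr.fn f) (RelStr.fn g)))

variable (σ k)

/-- The pebbling comonad `P_k` on `R(σ)`, obtained from its Kleisli form in the standard way:
`P_k f = (f ∘ ε)^*` and `δ = id^*`. -/
def pebbleComonad : Comonad (RelStr σ) where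
  obj A := pebbleObj σ k A
  map f := pebbleCoext (pebbleCounit _ ≫ f)
  map_id A := by rw [Category.comp_id, pebbleCoext_counit]
  map_comp f g := by
    rw [← pebbleCoext_comp, ← Category.assoc (pebbleCoext _), pebbleCoext_comp_counit,
      Category.assoc]
  ε :=
    { app := fun A => pebbleCounit A
      naturality := fun _ _ _ => pebbleCoext_comp_counit _ }
  δ :=
    { app := fun A => pebbleCoext (𝟙 _)
      naturality := fun A B f => by
        dsimp only [Functor.comp_map, Functor.comp_obj]
        rw [← pebbleCoext_comp, ← pebbleCoext_comp, ← Category.assoc (pebbleCoext (𝟙 _)),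
          pebbleCoext_comp_counit, Category.comp_id, Category.id_comp] }
  coassoc A := by
    dsimp only [Functor.comp_obj]
    rw [← pebbleCoext_comp, ← pebbleCoext_comp, ← Category.assoc, pebbleCoext_comp_counit,
      Category.id_comp, Category.comp_id]
  left_counit A := pebbleCoext_comp_counit _
  right_counit A := by
    dsimp only [Functor.comp_obj, Functor.id_obj]
    rw [← pebbleCoext_comp, ← Category.assoc, pebbleCoext_comp_counit, Category.id_comp,
      pebbleCoext_counit]

end Comonad

/-! ### The vocabulary `σ⁺ = σ ∪ {I}` and the relative comonad `P_k⁺` -/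

/-- The only symbol is a binary relation symbol `I`. -/
inductive IdSymbol : ℕ → Type
  | I : IdSymbol 2

/-- The vocabulary `{I}`. -/
def idLanguage : FirstOrder.Language.{0, 0} := ⟨fun _ => Empty, IdSymbol⟩

instance : idLanguage.IsRelational := fun _ => inferInstanceAs (IsEmpty Empty)

/-- The vocabulary `σ⁺ = σ ∪ {I}`. -/
abbrev plusLanguage (σ : FirstOrder.Language.{u, u}) : FirstOrder.Language.{u, u} := σ.sum idLanguage

/-- The structure `J A`: the expansion of `A` to `σ⁺` which interprets `I` as equality. -/
def plusObj {σ : FirstOrder.Language.{u, u}} [σ.IsRelational] (A : RelStr σ) : RelStr (plusLanguage σ) where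
  carrier := A
  str :=
    { funMap := fun F => isEmptyElim F
      RelMap := fun R => match R with
        | Sum.inl R => fun x => FirstOrder.Language.Structure.RelMap R x
        | Sum.inr IdSymbol.I => fun x => x 0 = x 1 }

/-- The embedding `J : R(σ) ⥤ R(σ⁺)`. -/
def plusFunctor (σ : FirstOrder.Language.{u, u}) [σ.IsRelational] : RelStr σ ⥤ RelStr (plusLanguage σ) where
  obj A := plusObj A
  map {A B} f := RelStr.homMk (A := plusObj A) (B := plusObj B) (RelStr.fn (A := A) (B := B) f) (by
    rintro n (R | R) x h
    · exact RelStr.fn_rel (A := A) (B := B) f R x h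
    · cases R
      exact congrArg (RelStr.fn (A := A) (B := B) f) h)

/-- The coKleisli category of `P_k` on `R(σ)`. -/
abbrev PebbleKl (σ : FirstOrder.Language.{u, u}) [σ.IsRelational] (k : ℕ) :=
  Cokleisli (pebbleComonad σ k)

/-- `A` as an object of the coKleisli category of `P_k`. -/
abbrev toKl {σ : FirstOrder.Language.{u, u}} [σ.IsRelational] (k : ℕ) (A : RelStr σ) : PebbleKl σ k :=
  Cokleisli.mk (pebbleComonad σ k) A

/-- The coKleisli category of the `J`-relative comonad `P_k⁺` on `R(σ)`: the objects are those of
`R(σ)`, the morphisms `A ⟶ B` are the homomorphisms `P_k (J A) ⟶ J B` of `σ⁺`-structures, and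
identities and composition are those of the coKleisli category of `P_k` on `R(σ⁺)`. -/
abbrev PebblePlusKl (σ : FirstOrder.Language.{u, u}) [σ.IsRelational] (k : ℕ) :=
  InducedCategory (PebbleKl (plusLanguage σ) k)
    (fun A : RelStr σ => toKl k ((plusFunctor σ).obj A))

/-- `A` as an object of the coKleisli category of `P_k⁺`. -/
abbrev toKlPlus {σ : FirstOrder.Language.{u, u}} [σ.IsRelational] (k : ℕ) (A : RelStr σ) :
    PebblePlusKl σ k := A

/-! ### Infinitary `k`-variable logic with counting quantifiers -/

/-- Formulas of the infinitary `k`-variable logic with counting quantifiers over a relational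
vocabulary. The variables are `x_0, …, x_{k-1}`; they can be requantified. Conjunctions and
disjunctions range over arbitrary (possibly empty or infinite) set-indexed families. -/
inductive KFormula (σ : FirstOrder.Language.{u, u}) (k : ℕ) : Type (u + 1)
  | eq (x y : Fin k) : KFormula σ k
  | rel {n : ℕ} (R : σ.Relations n) (x : Fin n → Fin k) : KFormula σ k
  | neg (φ : KFormula σ k) : KFormula σ k
  | conj (ι : Type u) (φ : ι → KFormula σ k) : KFormula σ k
  | disj (ι : Type u) (φ : ι → KFormula σ k) : KFormula σ k
  | ex (x : Fin k) (φ : KFormula σ k) : KFormula σ k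
  | all (x : Fin k) (φ : KFormula σ k) : KFormula σ k
  | exGE (n : ℕ) (x : Fin k) (φ : KFormula σ k) : KFormula σ k
  | exLE (n : ℕ) (x : Fin k) (φ : KFormula σ k) : KFormula σ k

namespace KFormula

variable {σ : FirstOrder.Language.{u, u}} {k : ℕ}

/-- The set of free variables. -/
def freeVars : KFormula σ k → Set (Fin k)
  | eq x y => {x, y}
  | rel _ x => Set.range x
  | neg φ => φ.freeVars
  | conj _ φ => ⋃ i, (φ i).freeVars
  | disj _ φ => ⋃ i, (φ i).freeVars
  | ex x φ => φ.freeVars \ {x}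
  | all x φ => φ.freeVars \ {x}
  | exGE _ x φ => φ.freeVars \ {x}
  | exLE _ x φ => φ.freeVars \ {x}

/-- A sentence is a formula without free variables. -/
def IsSentence (φ : KFormula σ k) : Prop := φ.freeVars = ∅

/-- Existential-positive formulas: built from atomic formulas by (infinitary) conjunction and
disjunction and existential quantification. -/
def IsExPos : KFormula σ k → Prop
  | eq _ _ => True
  | rel _ _ => True
  | neg _ => False
  | conj _ φ => ∀ i, (φ i).IsExPos
  | disj _ φ => ∀ i, (φ i).IsExPos
  | ex _ φ => φ.IsExPos
  | all _ _ => False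
  | exGE _ _ _ => False
  | exLE _ _ _ => False

/-- Satisfaction in `A` under a partial assignment `v` of elements to the variables. It has its
usual meaning whenever `v` is defined on the free variables of the formula; partial assignments are
used so that sentences can be evaluated (under the nowhere defined assignment) in every structure,
the empty one included. -/
def Sat (A : Type u) [σ.Structure A] : KFormula σ k → (Fin k → Option A) → Prop
  | eq x y, v => ∃ a, v x = some a ∧ v y = some a
  | rel R x, v => ∃ a, (∀ i, v (x i) = some (a i)) ∧ FirstOrder.Language.Structure.RelMap R a
  | neg φ, v => ¬ φ.Sat A v
  | conj _ φ, v => ∀ i, (φ i).Sat A v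
  | disj _ φ, v => ∃ i, (φ i).Sat A v
  | ex x φ, v => ∃ a, φ.Sat A (Function.update v x (some a))
  | all x φ, v => ∀ a, φ.Sat A (Function.update v x (some a))
  | exGE n x φ, v => (n : ℕ∞) ≤ {a : A | φ.Sat A (Function.update v x (some a))}.encard
  | exLE n x φ, v => {a : A | φ.Sat A (Function.update v x (some a))}.encard ≤ (n : ℕ∞)

/-- The sentence `φ` is true in `A`. -/
def Holds (φ : KFormula σ k) (A : RelStr σ) : Prop := φ.Sat A (fun _ => none)

end KFormula

/-- `A` and `B` satisfy the same existential-positive sentences of the infinitary `k`-variable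
logic. -/
def ExPosEquiv {σ : FirstOrder.Language.{u, u}} (k : ℕ) (A B : RelStr σ) : Prop :=
  ∀ φ : KFormula σ k, φ.IsSentence → φ.IsExPos → (φ.Holds A ↔ φ.Holds B)

/-- `A` and `B` satisfy the same sentences of the infinitary `k`-variable logic with counting
quantifiers. -/
def CountingEquiv {σ : FirstOrder.Language.{u, u}} (k : ℕ) (A B : RelStr σ) : Prop :=
  ∀ φ : KFormula σ k, φ.IsSentence → (φ.Holds A ↔ φ.Holds B)

/-! ### Positions of the pebbles after a sequence of moves -/

/-! A map on plays is a strategy for the second player in the existential `k`-pebble game: its value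
on a play is the reply to the last move. The side conditions on tuples in `P_k A` say that the plays
are prefixes of one play and that the pebbles of their last moves are still in place at its end. So
a map is a homomorphism exactly when every position it reaches preserves the relations
(`preservesRel_ofPlay`, `homOfPreservesRel`). Over `σ⁺`, equalities are preserved as well
(`preservesRel_plus_iff`).

For part 1, forth systems preserve existential-positive formulas, and the positions at which these
formulas transfer form a forth system, thanks to conjunctions indexed by the elements of `B`. A
strategy over `σ` may answer two pebbles on one element differently. It is repaired by consulting it
only for elements not yet pebbled and copying the earlier reply otherwise
(`isForthSystem_renamedPositions`). This closes the cycle from formulas to `P_k⁺` to `P_k` and back.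

For part 2, isomorphisms correspond to strategies that reply by bijections: two strategies that undo
one another restrict, after each history, to inverse bijections. Such strategies preserve counting
formulas. Conversely, each type realised by a next move is isolated by a single formula, counting
quantifiers make it equally frequent in `A` and `B`, and finiteness turns equal counts into a
bijection that respects types (`exists_equiv_put_mem_countingPositions`). -/

namespace Plays

variable {k : ℕ} {A B : Type u}

/-- The current placement of the pebbles after a sequence of moves. -/
def board (l : List (Fin k × A)) : Fin k → Option A :=
  l.foldl (fun v m => Function.update v m.1 (some m.2)) fun _ => none

@[simp] theorem board_nil : board ([] : List (Fin k × A)) = fun _ => none := rfl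

@[simp] theorem board_concat (l : List (Fin k × A)) (m : Fin k × A) :
    board (l ++ [m]) = Function.update (board l) m.1 (some m.2) := by
  simp [board]

theorem board_append_of_forall_ne (l w : List (Fin k × A)) (p : Fin k) (h : ∀ m ∈ w, m.1 ≠ p) :
    board (l ++ w) p = board l p := by
  induction w using List.reverseRecOn with
  | nil => simp
  | append_singleton w m ih =>
    rw [← List.append_assoc, board_concat, Function.update_of_ne (h m (by simp)).symm]
    exact ih fun m' hm' => h m' (by simp [hm'])

theorem board_lastMove (s : Plays k A) : board s.1 s.lastMove.1 = some s.counit := by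
  conv_lhs => rw [← List.dropLast_append_getLast s.2]
  rw [board_concat]
  exact Function.update_self ..

theorem board_append (s : Plays k A) (w : List (Fin k × A))
    (h : ∀ m ∈ w, m.1 ≠ s.lastMove.1) : board (s.1 ++ w) s.lastMove.1 = some s.counit := by
  rw [board_append_of_forall_ne _ _ _ h, board_lastMove]

/-- Cutting `l` just after the latest move of pebble `p` gives the play `s`. -/
theorem exists_of_board_eq_some {l : List (Fin k × A)} {p : Fin k} {a : A}
    (h : board l p = some a) : ∃ (s : Plays k A) (w : List (Fin k × A)),
      l = s.1 ++ w ∧ s.lastMove = (p, a) ∧ ∀ m ∈ w, m.1 ≠ p := by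
  induction l using List.reverseRecOn with
  | nil => simp at h
  | append_singleton l m ih =>
    by_cases hp : p = m.1
    · subst hp
      rw [board_concat, Function.update_self, Option.some_inj] at h
      exact ⟨⟨l ++ [m], by simp⟩, [], by simp, by simp [lastMove, ← h], by simp⟩
    · rw [board_concat, Function.update_of_ne hp] at h
      obtain ⟨s, w, rfl, hs, hw⟩ := ih h
      refine ⟨s, w ++ [m], by simp, hs, fun m' hm' => ?_⟩
      rcases List.mem_append.mp hm' with h' | h'
      · exact hw m' h'
      · rw [List.mem_singleton.mp h']
        exact Ne.symm hp

theorem board_ne_none_iff (l : List (Fin k × A)) (p : Fin k) :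
    board l p ≠ none ↔ p ∈ l.map Prod.fst := by
  induction l using List.reverseRecOn with
  | nil => simp
  | append_singleton l m ih =>
    by_cases hp : p = m.1
    · simp [hp]
    · rw [board_concat, Function.update_of_ne hp, ih]
      simp [hp]

/-- The coextension on possibly empty sequences of moves. -/
def coextList (f : Plays k A → B) (l : List (Fin k × A)) : List (Fin k × B) :=
  l.mapFinIdx fun i m hi => (m.1, f ⟨l.take (i + 1), by
    rw [Ne, List.take_eq_nil_iff]
    rintro (h | h)
    · omega
    · simp [h] at hi⟩)

theorem coe_coext (f : Plays k A → B) (s : Plays k A) : (coext f s).1 = coextList f s.1 := rfl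

@[simp] theorem coextList_nil (f : Plays k A → B) : coextList f [] = [] := rfl

@[simp] theorem coextList_concat (f : Plays k A → B) (l : List (Fin k × A)) (m : Fin k × A) :
    coextList f (l ++ [m]) = coextList f l ++ [(m.1, f ⟨l ++ [m], by simp⟩)] := by
  apply List.ext_getElem
  · simp [coextList]
  · intro i h1 h2
    simp only [coextList, List.length_mapFinIdx, List.length_append, List.length_singleton] at h1
    rcases Nat.lt_or_ge i l.length with hi | hi
    · have e : (l ++ [m]).take (i + 1) = l.take (i + 1) := List.take_append_of_le_length hi
      simp [coextList, hi, e]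
    · obtain rfl : i = l.length := by omega
      have e : (l ++ [m]).take (l.length + 1) = l ++ [m] := List.take_of_length_le (by simp)
      simp [coextList, e]

theorem map_fst_coextList (f : Plays k A → B) (l : List (Fin k × A)) :
    (coextList f l).map Prod.fst = l.map Prod.fst := by
  induction l using List.reverseRecOn with
  | nil => rfl
  | append_singleton l m ih => simp [ih]

theorem coextList_prefix (f : Plays k A → B) (l w : List (Fin k × A)) :
    coextList f l <+: coextList f (l ++ w) := by
  induction w using List.reverseRecOn with
  | nil => simp
  | append_singleton w m ih =>
    rw [← List.append_assoc, coextList_concat]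
    exact ih.trans (List.prefix_append ..)

/-- Coextension keeps pebble indices, so a pebble left alone in `A` after `s` is left alone in `B`
and still shows the reply made at `s`. -/
theorem board_coextList_append (f : Plays k A → B) (s : Plays k A) (w : List (Fin k × A))
    (h : ∀ m ∈ w, m.1 ≠ s.lastMove.1) :
    board (coextList f (s.1 ++ w)) s.lastMove.1 = some (f s) := by
  obtain ⟨w', hw'⟩ := coextList_prefix f s.1 w
  have hmap := congrArg (List.map Prod.fst) hw'
  rw [List.map_append, map_fst_coextList, map_fst_coextList, List.map_append] at hmap
  have hww := List.append_cancel_left hmap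
  have hl : (coext f s).lastMove.1 = s.lastMove.1 := by rw [lastMove_coext]
  rw [← hw', ← coe_coext, ← hl, ← counit_coext f s]
  refine board_append _ _ fun m hm => ?_
  have hm' : m.1 ∈ w.map Prod.fst := hww ▸ List.mem_map_of_mem hm
  obtain ⟨m', h1, h2⟩ := List.mem_map.mp hm'
  rw [hl, ← h2]
  exact h m' h1

theorem board_coextList_ne_none_iff (f : Plays k A → B) (l : List (Fin k × A)) (p : Fin k) :
    board (coextList f l) p ≠ none ↔ board l p ≠ none := by
  rw [board_ne_none_iff, board_ne_none_iff, map_fst_coextList]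

end Plays

/-! ### Pairs of placements -/

/-- A pair of placements of `k` pebbles, in `A` and in `B`. -/
abbrev Position (k : ℕ) (A B : Type u) : Type u := (Fin k → Option A) × (Fin k → Option B)

namespace Position

variable {k : ℕ} {A B : Type u}

/-- The position before any pebble has been placed. -/
def start : Position k A B := (fun _ => none, fun _ => none)

/-- Place the pebbles `p` on `a` and `b`. -/
def put (x : Position k A B) (p : Fin k) (a : A) (b : B) : Position k A B :=
  (Function.update x.1 p (some a), Function.update x.2 p (some b))

/-- The relations that hold between pebbled elements of `A` also hold between the corresponding
elements of `B`. -/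
def PreservesRel (L : FirstOrder.Language.{u, u}) [L.Structure A] [L.Structure B]
    (x : Position k A B) : Prop :=
  ∀ (n : ℕ) (R : L.Relations n) (y : Fin n → Fin k) (a : Fin n → A),
    (∀ i, x.1 (y i) = some (a i)) → FirstOrder.Language.Structure.RelMap R a →
      ∃ b : Fin n → B, (∀ i, x.2 (y i) = some (b i)) ∧ FirstOrder.Language.Structure.RelMap R b

/-- Equalities between pebbled elements of `A` also hold in `B`. -/
def PreservesEq (x : Position k A B) : Prop :=
  ∀ p q a, x.1 p = some a → x.1 q = some a → ∃ b, x.2 p = some b ∧ x.2 q = some b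

/-- The position reached by the sequence of moves `l` when the second player follows `f`. -/
def ofPlay (f : Plays k A → B) (l : List (Fin k × A)) : Position k A B :=
  (Plays.board l, Plays.board (Plays.coextList f l))

@[simp] theorem ofPlay_nil (f : Plays k A → B) : ofPlay f [] = start := rfl

@[simp] theorem ofPlay_concat (f : Plays k A → B) (l : List (Fin k × A)) (m : Fin k × A) :
    ofPlay f (l ++ [m]) = (ofPlay f l).put m.1 m.2 (f ⟨l ++ [m], by simp⟩) := by
  simp [ofPlay, put]

end Position

/-! ### Homomorphisms out of `P_k A` as strategies -/

section Homomorphisms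

variable {L : FirstOrder.Language.{u, u}} [L.IsRelational] {k : ℕ} {A B : RelStr L}

/-- The prefixes of `l` that end with the latest move of each pebble satisfy `Plays.Current`, so a
relation between pebbled elements lifts to these prefixes and `f` can be applied. -/
theorem preservesRel_ofPlay (f : pebbleObj L k A ⟶ B) (l : List (Fin k × A)) :
    (Position.ofPlay (B := B) (RelStr.fn f) l).PreservesRel L := by
  intro n R y a hy hR
  choose s w hl hs hw using fun i => Plays.exists_of_board_eq_some (hy i)
  have hs1 : ∀ i, (s i).lastMove.1 = y i := fun i => by rw [hs]
  refine ⟨fun i => RelStr.fn f (s i), fun i => ?_, RelStr.fn_rel f R s ⟨⟨fun i j => ?_, ?_⟩, ?_⟩⟩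
  · have := Plays.board_coextList_append (B := B) (RelStr.fn f) (s i) (w i)
      (by rw [hs1]; exact hw i)
    rw [hs1, ← hl] at this
    exact this
  · exact List.prefix_or_prefix_of_prefix (l₃ := l) ⟨w i, (hl i).symm⟩ ⟨w j, (hl j).symm⟩
  · intro i j w' hw' m hm
    rw [hs1]
    refine hw i m ?_
    have := (hl i).symm.trans (hl j)
    rw [hw', List.append_assoc] at this
    rw [List.append_cancel_left this]
    exact List.mem_append_left _ hm
  · have : (fun i => (s i).counit) = a := funext fun i => by rw [Plays.counit, hs]
    exact this ▸ hR

/-- A map on plays all of whose positions preserve the relations is a homomorphism. -/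
def homOfPreservesRel (f : Plays k A → B)
    (hf : ∀ l, (Position.ofPlay f l).PreservesRel L) : pebbleObj L k A ⟶ B :=
  RelStr.homMk (A := pebbleObj L k A) f fun {n} R s h => by
    obtain ⟨⟨hc, hw⟩, hR⟩ := h
    -- Comparable plays are all prefixes of the longest one, at whose end the pebbles in question
    -- are all in place. An empty tuple has no longest play, and there the empty list serves.
    have key : ∃ l : List (Fin k × A), ∀ i, ∃ w, l = (s i).1 ++ w ∧
        ∀ m ∈ w, m.1 ≠ (s i).lastMove.1 := by
      rcases n with _ | n
      · exact ⟨[], fun i => i.elim0⟩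
      · obtain ⟨j, hj⟩ := Finite.exists_max fun i => (s i).1.length
        refine ⟨(s j).1, fun i => ?_⟩
        have hp : (s i).1 <+: (s j).1 := by
          rcases hc i j with h1 | h1
          · exact h1
          · rw [h1.eq_of_length_le (hj i)]
        obtain ⟨w, e⟩ := hp
        exact ⟨w, e.symm, hw i j w e.symm⟩
    obtain ⟨l, hl⟩ := key
    choose w hl hw using hl
    obtain ⟨b, hb, hRb⟩ := hf l n R (fun i => (s i).lastMove.1) (fun i => (s i).counit)
      (fun i => by
        have := Plays.board_append (s i) (w i) (hw i)
        rwa [← hl] at this) hR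
    have : b = f ∘ s := funext fun i => by
      have h1 := Plays.board_coextList_append f (s i) (w i) (hw i)
      rw [← hl] at h1
      exact Option.some_injective _ ((hb i).symm.trans h1)
    exact this ▸ hRb

end Homomorphisms

section Plus

variable {σ : FirstOrder.Language.{u, u}} [σ.IsRelational] {k : ℕ} {A B : RelStr σ}

theorem preservesRel_plus_iff (x : Position k A B) :
    Position.PreservesRel (A := plusObj A) (B := plusObj B) (plusLanguage σ) x ↔
      x.PreservesRel σ ∧ x.PreservesEq := by
  constructor
  · refine fun h => ⟨fun n R y a ha hR => h n (Sum.inl R) y a ha hR, fun p q a hp hq => ?_⟩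
    obtain ⟨b, hb, hI⟩ := h 2 (Sum.inr IdSymbol.I) ![p, q] ![a, a]
      (fun i => by fin_cases i; exacts [hp, hq]) rfl
    have hI : b 0 = b 1 := hI
    exact ⟨b 0, hb 0, hI ▸ hb 1⟩
  · rintro ⟨h1, h2⟩ n (R | R) y a ha hR
    · exact h1 n R y a ha hR
    · cases R
      have hR : a 0 = a 1 := hR
      obtain ⟨b, hb0, hb1⟩ := h2 (y 0) (y 1) (a 0) (ha 0) (hR ▸ ha 1)
      exact ⟨fun _ => b, fun i => by fin_cases i <;> assumption, rfl⟩

end Plus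

/-! ### Strategies that depend only on the position -/

section Strategies

variable {k : ℕ} {A B : Type u}

/-- The strategy that replies `r x p a` to the move `(p, a)` in the position `x`. -/
def Position.run (r : Position k A B → Fin k → A → B) (l : List (Fin k × A)) : Position k A B :=
  l.foldl (fun x m => x.put m.1 m.2 (r x m.1 m.2)) Position.start

/-- The last reply after a play, when the second player follows `r`. -/
def Position.lastReply (r : Position k A B → Fin k → A → B) (s : Plays k A) : B :=
  r (Position.run r s.1.dropLast) s.lastMove.1 s.lastMove.2

theorem Position.lastReply_concat (r : Position k A B → Fin k → A → B) (l : List (Fin k × A))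
    (m : Fin k × A) (h : l ++ [m] ≠ []) :
    Position.lastReply r ⟨l ++ [m], h⟩ = r (Position.run r l) m.1 m.2 := by
  simp [lastReply, Plays.lastMove]

theorem Position.run_concat (r : Position k A B → Fin k → A → B) (l : List (Fin k × A))
    (m : Fin k × A) : Position.run r (l ++ [m]) =
      (Position.run r l).put m.1 m.2 (r (Position.run r l) m.1 m.2) := by
  simp [run]

/-- This transfers closure of a set of positions under `r` to all positions reached by the induced
map on plays. -/
theorem Position.ofPlay_lastReply (r : Position k A B → Fin k → A → B) (l : List (Fin k × A)) :
    Position.ofPlay (Position.lastReply r) l = Position.run r l := by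
  induction l using List.reverseRecOn with
  | nil => rfl
  | append_singleton l m ih =>
    rw [Position.ofPlay_concat, ih, Position.lastReply_concat, Position.run_concat]

theorem Position.run_mem {S : Set (Position k A B)} (h0 : Position.start ∈ S)
    (r : Position k A B → Fin k → A → B) (hr : ∀ x ∈ S, ∀ p a, x.put p a (r x p a) ∈ S)
    (l : List (Fin k × A)) : Position.run r l ∈ S := by
  induction l using List.reverseRecOn with
  | nil => exact h0
  | append_singleton l m ih =>
    rw [Position.run_concat]
    exact hr _ ih _ _

end Strategies

/-! ### Forth systems and existential-positive formulas -/

section Forth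

variable {σ : FirstOrder.Language.{u, u}} {k : ℕ} {A B : RelStr σ}

/-- A winning strategy of the second player in the existential `k`-pebble game, presented as a set
of positions. -/
structure IsForthSystem (S : Set (Position k A B)) : Prop where
  start_mem : Position.start ∈ S
  preservesRel : ∀ x ∈ S, x.PreservesRel σ
  preservesEq : ∀ x ∈ S, x.PreservesEq
  forth : ∀ x ∈ S, ∀ p a, ∃ b, x.put p a b ∈ S

theorem IsForthSystem.sat {S : Set (Position k A B)} (hS : IsForthSystem S)
    (φ : KFormula σ k) (hφ : φ.IsExPos) (x : Position k A B) (hx : x ∈ S) (h : φ.Sat A x.1) :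
    φ.Sat B x.2 := by
  induction φ generalizing x with
  | eq p q =>
    obtain ⟨a, hp, hq⟩ := h
    exact hS.preservesEq x hx p q a hp hq
  | rel R y =>
    obtain ⟨a, ha, hR⟩ := h
    exact hS.preservesRel x hx _ R y a ha hR
  | conj ι φ ih => exact fun i => ih i (hφ i) x hx (h i)
  | disj ι φ ih =>
    obtain ⟨i, hi⟩ := h
    exact ⟨i, ih i (hφ i) x hx hi⟩
  | ex p φ ih =>
    obtain ⟨a, ha⟩ := h
    obtain ⟨b, hb⟩ := hS.forth x hx p a
    exact ⟨b, ih hφ _ hb ha⟩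
  | neg | all | exGE | exLE => exact hφ.elim

/-- The positions at which the existential-positive formulas true in `A` are true in `B`. -/
def exPosPositions (k : ℕ) (A B : RelStr σ) : Set (Position k A B) :=
  {x | ∀ φ : KFormula σ k, φ.IsExPos → (∀ p ∈ φ.freeVars, x.1 p ≠ none) →
    φ.Sat A x.1 → φ.Sat B x.2}

/-- Formulas are tested only when their free variables are pebbled, so at the start only sentences
matter and the hypothesis suffices. -/
theorem isForthSystem_exPosPositions
    (h : ∀ φ : KFormula σ k, φ.IsSentence → φ.IsExPos → φ.Holds A → φ.Holds B) :
    IsForthSystem (exPosPositions k A B) where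
  start_mem φ hφ hfv := h φ (Set.eq_empty_of_forall_notMem fun p hp => hfv p hp rfl) hφ
  preservesRel x hx n R y a ha hR :=
    hx (.rel R y) trivial (by rintro _ ⟨i, rfl⟩; simp [ha i]) ⟨a, ha, hR⟩
  preservesEq x hx p q a hp hq :=
    hx (.eq p q) trivial (by rintro r (rfl | rfl) <;> simp [*]) ⟨a, hp, hq⟩
  forth x hx p a := by
    -- If every reply `b` fails, each has a formula `φ b` true at `a` and false at `b`. Then `∃ x_p
    -- ⋀_b φ b` holds in `A`, hence in `B`, and its witness contradicts its own conjunct.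
    by_contra! hcon
    have : ∀ b : B, ∃ φ : KFormula σ k, φ.IsExPos ∧
        (∀ q ∈ φ.freeVars, (x.put p a b).1 q ≠ none) ∧ φ.Sat A (x.put p a b).1 ∧
        ¬ φ.Sat B (x.put p a b).2 := by
      intro b
      have := hcon b
      simp only [exPosPositions, Set.mem_ofPred_eq] at this
      push Not at this
      exact this
    choose φ hφ hfv hA hB using this
    obtain ⟨b, hb⟩ := hx (.ex p (.conj B φ)) hφ (by
      rintro q ⟨hq, hqp⟩
      obtain ⟨b, hb⟩ := Set.mem_iUnion.mp hq
      have := hfv b q hb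
      simp only [Position.put] at this
      rwa [Function.update_of_ne hqp] at this) ⟨a, hA⟩
    exact hB b (hb b)

theorem IsForthSystem.exists_reply {S : Set (Position k A B)} (hS : IsForthSystem S) :
    ∃ r : Position k A B → Fin k → A → B, ∀ x ∈ S, ∀ p a, x.put p a (r x p a) ∈ S := by
  have : ∀ (x : Position k A B) (p : Fin k) (a : A), ∃ b, x ∈ S → x.put p a b ∈ S := by
    intro x p a
    by_cases hx : x ∈ S
    · obtain ⟨b, hb⟩ := hS.forth x hx p a
      exact ⟨b, fun _ => hb⟩
    -- Outside `S` any reply will do; the start position shows that one exists.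
    · obtain ⟨b, -⟩ := hS.forth _ hS.start_mem p a
      exact ⟨b, fun h => absurd h hx⟩
  choose r hr using this
  exact ⟨r, fun x hx p a => hr x p a hx⟩

/-- The positions arising from those in `S` by renaming the pebbles, so that pebbles placed on the
same element of `A` come from the same pebble. -/
def renamedPositions (S : Set (Position k A B)) : Set (Position k A B) :=
  {x | ∃ y ∈ S, ∃ τ : Fin k → Fin k,
    (∀ p a, x.1 p = some a → y.1 (τ p) = some a ∧ x.2 p = y.2 (τ p)) ∧
    ∀ p q a, x.1 p = some a → x.1 q = some a → τ p = τ q}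

/-- The pebbles of `x` on one element share a single pebble of the simulated position `y`, and thus
a single reply, which forces preservation of equality. -/
theorem isForthSystem_renamedPositions {S : Set (Position k A B)}
    (start_mem : Position.start ∈ S) (dom : ∀ x ∈ S, ∀ p, x.1 p ≠ none → x.2 p ≠ none)
    (preservesRel : ∀ x ∈ S, x.PreservesRel σ) (forth : ∀ x ∈ S, ∀ p a, ∃ b, x.put p a b ∈ S) :
    IsForthSystem (renamedPositions S) where
  start_mem := ⟨_, start_mem, id, by simp [Position.start], by simp [Position.start]⟩
  preservesRel := by
    rintro x ⟨y, hy, τ, h1, -⟩ n R z a ha hR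
    obtain ⟨b, hb, hRb⟩ := preservesRel y hy n R (τ ∘ z) a (fun i => (h1 _ _ (ha i)).1) hR
    exact ⟨b, fun i => (h1 _ _ (ha i)).2.trans (hb i), hRb⟩
  preservesEq := by
    rintro x ⟨y, hy, τ, h1, h2⟩ p q a hp hq
    have := dom y hy (τ p) (by rw [(h1 p a hp).1]; simp)
    obtain ⟨b, hb⟩ := Option.ne_none_iff_exists'.mp this
    exact ⟨b, (h1 p a hp).2.trans hb, (h1 q a hq).2.trans (h2 p q a hp hq ▸ hb)⟩
  forth := by
    rintro x ⟨y, hy, τ, h1, h2⟩ p a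
    -- If another pebble already lies on `a`, its reply is copied and `y` does not change. Otherwise
    -- a free pebble `t` of `y` is moved to `a`.
    by_cases hq : ∃ q, q ≠ p ∧ x.1 q = some a
    · obtain ⟨q, hqp, hq⟩ := hq
      obtain ⟨b, hb⟩ := Option.ne_none_iff_exists'.mp
        (dom y hy (τ q) (by rw [(h1 q a hq).1]; simp))
      refine ⟨b, y, hy, Function.update τ p (τ q), fun p' a' h => ?_, fun p' q' a' hp' hq' => ?_⟩
      · by_cases hp : p' = p
        · subst hp
          simp only [Position.put, Function.update_self, Option.some_inj] at h ⊢
          subst h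
          exact ⟨(h1 q a hq).1, hb.symm⟩
        · simp only [Position.put, Function.update_of_ne hp] at h ⊢
          exact h1 p' a' h
      · have key : ∀ r, (x.put p a b).1 r = some a' →
            ∃ r', x.1 r' = some a' ∧ Function.update τ p (τ q) r = τ r' := by
          intro r hr
          by_cases hrp : r = p
          · subst hrp
            simp only [Position.put, Function.update_self, Option.some_inj] at hr ⊢
            exact ⟨q, hr ▸ hq, rfl⟩
          · simp only [Position.put, Function.update_of_ne hrp] at hr ⊢
            exact ⟨r, hr, rfl⟩
        obtain ⟨p'', hp1, hp2⟩ := key p' hp'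
        obtain ⟨q'', hq1, hq2⟩ := key q' hq'
        rw [hp2, hq2]
        exact h2 _ _ _ hp1 hq1
    · push Not at hq
      -- The pebbles other than `p` number `k - 1`, so `τ` misses some `t` on them: otherwise a
      -- section of `τ` avoiding `p` would be an injective, hence surjective, self-map of `Fin k`.
      obtain ⟨t, ht⟩ : ∃ t, ∀ q, q ≠ p → τ q ≠ t := by
        by_contra! hcon
        choose g hg hgt using hcon
        have hinj : Function.Injective g := fun s t hst => by rw [← hgt s, ← hgt t, hst]
        obtain ⟨s, hs⟩ := Finite.surjective_of_injective hinj p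
        exact hg s hs
      obtain ⟨b, hb⟩ := forth y hy t a
      refine ⟨b, _, hb, Function.update τ p t, fun p' a' h => ?_, fun p' q' a' hp' hq' => ?_⟩
      · by_cases hp : p' = p
        · subst hp
          simpa [Position.put] using h
        · simp only [Position.put, Function.update_of_ne hp,
            Function.update_of_ne (ht p' hp)] at h ⊢
          exact h1 p' a' h
      · by_cases hp : p' = p <;> by_cases hq'p : q' = p
        · rw [hp, hq'p]
        · subst hp
          simp only [Position.put, Function.update_self, Option.some_inj,
            Function.update_of_ne hq'p] at hp' hq'
          exact absurd (hp' ▸ hq') (hq q' hq'p)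
        · subst hq'p
          simp only [Position.put, Function.update_self, Option.some_inj,
            Function.update_of_ne hp] at hp' hq'
          exact absurd (hq' ▸ hp') (hq p' hp)
        · simp only [Position.put, Function.update_of_ne hp, Function.update_of_ne hq'p]
            at hp' hq' ⊢
          exact h2 _ _ _ hp' hq'

theorem exPosEquiv_iff (k : ℕ) (A B : RelStr σ) : ExPosEquiv k A B ↔
    (∀ φ : KFormula σ k, φ.IsSentence → φ.IsExPos → φ.Holds A → φ.Holds B) ∧
    (∀ φ : KFormula σ k, φ.IsSentence → φ.IsExPos → φ.Holds B → φ.Holds A) :=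
  ⟨fun h => ⟨fun φ hs hφ => (h φ hs hφ).mp, fun φ hs hφ => (h φ hs hφ).mpr⟩,
    fun h φ hs hφ => ⟨h.1 φ hs hφ, h.2 φ hs hφ⟩⟩

end Forth

/-! ### Existential-positive formulas and coKleisli morphisms -/

section Morphisms

variable {σ : FirstOrder.Language.{u, u}} [σ.IsRelational] {k : ℕ} {A B : RelStr σ}

theorem IsForthSystem.nonempty_hom {S : Set (Position k A B)} (hS : IsForthSystem S) :
    Nonempty (pebbleObj (plusLanguage σ) k (plusObj A) ⟶ plusObj B) := by
  obtain ⟨r, hr⟩ := hS.exists_reply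
  refine ⟨homOfPreservesRel (A := plusObj A) (B := plusObj B) (Position.lastReply r)
    fun (l : List (Fin k × A)) => ?_⟩
  have hl := Position.run_mem hS.start_mem r hr l
  rw [← Position.ofPlay_lastReply] at hl
  exact (preservesRel_plus_iff _).mpr ⟨hS.preservesRel _ hl, hS.preservesEq _ hl⟩

/-- The reduct to `σ` of a homomorphism over `σ⁺`. -/
def pebbleReduct (f : pebbleObj (plusLanguage σ) k (plusObj A) ⟶ plusObj B) :
    pebbleObj σ k A ⟶ B :=
  RelStr.homMk (A := pebbleObj σ k A) (B := B)
    (RelStr.fn (A := pebbleObj (plusLanguage σ) k (plusObj A)) (B := plusObj B) f)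
    fun {n} R x h => RelStr.fn_rel (A := pebbleObj (plusLanguage σ) k (plusObj A))
      (B := plusObj B) f (n := n) (Sum.inl R) x h

/-- The positions reached by `f` can fail only to preserve equality, which renaming the pebbles
repairs. -/
theorem exists_isForthSystem (f : pebbleObj σ k A ⟶ B) :
    ∃ S : Set (Position k A B), IsForthSystem S :=
  ⟨_, isForthSystem_renamedPositions
    (S := Set.range (Position.ofPlay (A := A) (B := B) (RelStr.fn f)))
    ⟨[], rfl⟩
    (by rintro _ ⟨l, rfl⟩ p hp; exact (Plays.board_coextList_ne_none_iff _ _ _).mpr hp)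
    (by rintro _ ⟨l, rfl⟩; exact preservesRel_ofPlay f l)
    (by
      rintro _ ⟨l, rfl⟩ p a
      exact ⟨_, l ++ [(p, a)], Position.ofPlay_concat _ _ _⟩)⟩

theorem exPos_preserved_of_hom (f : pebbleObj σ k A ⟶ B) (φ : KFormula σ k) (hφ : φ.IsExPos)
    (h : φ.Holds A) : φ.Holds B := by
  obtain ⟨S, hS⟩ := exists_isForthSystem f
  exact hS.sat φ hφ _ hS.start_mem h

theorem exPos_preserved_tfae (k : ℕ) (A B : RelStr σ) : List.TFAE [
    ∀ φ : KFormula σ k, φ.IsSentence → φ.IsExPos → φ.Holds A → φ.Holds B,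
    Nonempty (toKlPlus k A ⟶ toKlPlus k B),
    Nonempty (toKl k A ⟶ toKl k B)] := by
  tfae_have 1 → 2 := fun h =>
    (isForthSystem_exPosPositions h).nonempty_hom.map fun f => ⟨⟨f⟩⟩
  tfae_have 2 → 3 := fun ⟨f⟩ => ⟨⟨pebbleReduct f.hom.of⟩⟩
  tfae_have 3 → 1 := fun ⟨f⟩ φ _ hφ h => exPos_preserved_of_hom f.of φ hφ h
  tfae_finish

end Morphisms

/-! ### Bijective systems and counting quantifiers -/

/-- Fibrewise bijections glue. Finiteness is essential, as `encard` does not distinguish infinite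
cardinals. -/
theorem exists_equiv_of_encard_fiber_eq {α β γ : Type*} [Finite α] [Finite β] (f : α → γ)
    (g : β → γ) (h : ∀ c, {a | f a = c}.encard = {b | g b = c}.encard) :
    ∃ e : α ≃ β, ∀ a, g (e a) = f a := by
  have : ∀ c, Nonempty ({a // f a = c} ≃ {b // g b = c}) := fun c =>
    Finite.card_eq.mp (congrArg ENat.toNat (h c))
  let E := fun c => (this c).some
  exact ⟨(Equiv.sigmaFiberEquiv f).symm.trans
    ((Equiv.sigmaCongrRight E).trans (Equiv.sigmaFiberEquiv g)), fun a => (E (f a) ⟨a, rfl⟩).2⟩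

/-- Given a family of interpretations of the formulas, some formula with free variables in `D`
defines the members of the family at which exactly the formulas in `τ` are true. -/
theorem KFormula.exists_isolating {σ : FirstOrder.Language.{u, u}} {k : ℕ} {ι : Type u}
    (ρ : ι → KFormula σ k → Prop) (hneg : ∀ c φ, ρ c (.neg φ) ↔ ¬ ρ c φ)
    (hconj : ∀ c (κ : Type u) φ, ρ c (.conj κ φ) ↔ ∀ i, ρ c (φ i)) (D : Set (Fin k))
    (τ : Set {φ : KFormula σ k // φ.freeVars ⊆ D}) :
    ∃ ψ : KFormula σ k, ψ.freeVars ⊆ D ∧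
      ∀ c, ρ c ψ ↔ {φ : {φ : KFormula σ k // φ.freeVars ⊆ D} | ρ c φ.1} = τ := by
  -- Each `c` gets a formula true at all members of type `τ` and, if `c` has another type, false at
  -- `c`: a formula on which they disagree, or its negation. The conjunction over all `c` isolates
  -- `τ`.
  have : ∀ c, ∃ χ : KFormula σ k, χ.freeVars ⊆ D ∧
      (ρ c χ → {φ : {φ : KFormula σ k // φ.freeVars ⊆ D} | ρ c φ.1} = τ) ∧
      ∀ c', {φ : {φ : KFormula σ k // φ.freeVars ⊆ D} | ρ c' φ.1} = τ → ρ c' χ := by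
    intro c
    by_cases hc : {φ : {φ : KFormula σ k // φ.freeVars ⊆ D} | ρ c φ.1} = τ
    · exact ⟨.conj PEmpty fun i => i.elim, Set.iUnion_subset fun i => i.elim, fun _ => hc,
        fun c' _ => (hconj ..).mpr fun i => i.elim⟩
    · obtain ⟨φ, hφ⟩ : ∃ φ : {φ : KFormula σ k // φ.freeVars ⊆ D}, ¬ (ρ c φ.1 ↔ φ ∈ τ) := by
        by_contra! hcon
        exact hc (Set.ext hcon)
      by_cases hτ : φ ∈ τ
      · exact ⟨φ.1, φ.2, fun h => absurd (iff_of_true h hτ) hφ, fun c' hc' => hc'.symm.subset hτ⟩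
      · refine ⟨.neg φ.1, φ.2, fun h => absurd (iff_of_false ((hneg _ _).mp h) hτ) hφ,
          fun c' hc' => (hneg _ _).mpr fun h => hτ (hc'.subset h)⟩
  choose χ hD h1 h2 using this
  exact ⟨.conj ι χ, Set.iUnion_subset hD, fun c => (hconj ..).trans
    ⟨fun h => h1 c (h c), fun h i => h2 i c h⟩⟩

section Bijective

variable {σ : FirstOrder.Language.{u, u}} {k : ℕ} {A B : RelStr σ}

/-- A winning strategy of the second player in the bijective `k`-pebble game, presented as a set
of positions. -/
structure IsBijectiveSystem (S : Set (Position k A B)) : Prop where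
  start_mem : Position.start ∈ S
  preservesRel : ∀ x ∈ S, x.PreservesRel σ
  preservesEq : ∀ x ∈ S, x.PreservesEq
  preservesRel_swap : ∀ x ∈ S, Position.PreservesRel (A := B) (B := A) σ x.swap
  preservesEq_swap : ∀ x ∈ S, Position.PreservesEq x.swap
  bij : ∀ x ∈ S, ∀ p, ∃ e : A ≃ B, ∀ a, x.put p a (e a) ∈ S

theorem IsBijectiveSystem.sat_iff {S : Set (Position k A B)} (hS : IsBijectiveSystem S)
    (φ : KFormula σ k) (x : Position k A B) (hx : x ∈ S) : φ.Sat A x.1 ↔ φ.Sat B x.2 := by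
  -- The reply bijection carries the solution set in `A` onto the one in `B`.
  have encard_eq : ∀ (p : Fin k) (φ : KFormula σ k),
      (∀ x ∈ S, φ.Sat A x.1 ↔ φ.Sat B x.2) → ∀ x ∈ S,
      {a : A | φ.Sat A (Function.update x.1 p (some a))}.encard =
        {b : B | φ.Sat B (Function.update x.2 p (some b))}.encard := by
    intro p φ ih x hx
    obtain ⟨e, he⟩ := hS.bij x hx p
    refine Set.encard_congr (e.subtypeEquiv fun a => ih _ (he a))
  induction φ generalizing x with
  | eq p q =>
    exact ⟨fun ⟨a, hp, hq⟩ => hS.preservesEq x hx p q a hp hq,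
      fun ⟨a, hp, hq⟩ => hS.preservesEq_swap x hx p q a hp hq⟩
  | rel R y =>
    exact ⟨fun ⟨a, ha, hR⟩ => hS.preservesRel x hx _ R y a ha hR,
      fun ⟨a, ha, hR⟩ => hS.preservesRel_swap x hx _ R y a ha hR⟩
  | neg φ ih => exact not_congr (ih x hx)
  | conj ι φ ih => exact forall_congr' fun i => ih i x hx
  | disj ι φ ih => exact exists_congr fun i => ih i x hx
  | ex p φ ih =>
    obtain ⟨e, he⟩ := hS.bij x hx p
    exact e.exists_congr fun a => ih _ (he a)
  | all p φ ih =>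
    obtain ⟨e, he⟩ := hS.bij x hx p
    exact e.forall_congr fun a => ih _ (he a)
  | exGE n p φ ih => simp only [KFormula.Sat, encard_eq p φ ih x hx]
  | exLE n p φ ih => simp only [KFormula.Sat, encard_eq p φ ih x hx]

/-- The positions at which the same formulas are true in `A` and in `B`. -/
def countingPositions (k : ℕ) (A B : RelStr σ) : Set (Position k A B) :=
  {x | (∀ p, x.1 p = none ↔ x.2 p = none) ∧
    ∀ φ : KFormula σ k, (∀ p ∈ φ.freeVars, x.1 p ≠ none) → (φ.Sat A x.1 ↔ φ.Sat B x.2)}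

theorem exists_equiv_put_mem_countingPositions [Finite A] [Finite B] (x : Position k A B)
    (hx : x ∈ countingPositions k A B) (p : Fin k) :
    ∃ e : A ≃ B, ∀ a, x.put p a (e a) ∈ countingPositions k A B := by
  -- `D` consists of the variables defined once `p` is placed, and `T` is the type of a candidate
  -- move, in either structure, over these variables.
  let D : Set (Fin k) := {q | q = p ∨ x.1 q ≠ none}
  let ρ : A ⊕ B → KFormula σ k → Prop := Sum.elim
    (fun a φ => φ.Sat A (Function.update x.1 p (some a)))
    (fun b φ => φ.Sat B (Function.update x.2 p (some b)))
  let T : A ⊕ B → Set {φ : KFormula σ k // φ.freeVars ⊆ D} := fun c => {φ | ρ c φ.1}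
  obtain ⟨e, he⟩ : ∃ e : A ≃ B, ∀ a, T (Sum.inr (e a)) = T (Sum.inl a) := by
    refine exists_equiv_of_encard_fiber_eq (fun a => T (Sum.inl a)) (fun b => T (Sum.inr b))
      fun τ => ?_
    obtain ⟨ψ, hψ, h⟩ := KFormula.exists_isolating ρ (by rintro (a | b) φ <;> rfl)
      (by rintro (a | b) κ φ <;> rfl) D τ
    have hA : {a | T (Sum.inl a) = τ} = {a : A | ψ.Sat A (Function.update x.1 p (some a))} :=
      Set.ext fun a => (h (Sum.inl a)).symm
    have hB : {b | T (Sum.inr b) = τ} = {b : B | ψ.Sat B (Function.update x.2 p (some b))} :=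
      Set.ext fun b => (h (Sum.inr b)).symm
    rw [hA, hB]
    -- The formulas `∃_{≥n} x_p ψ`, whose free variables are pebbled in `x`, determine how often the
    -- type isolated by `ψ` is realised.
    exact ENat.eq_of_forall_natCast_le_iff fun n =>
      hx.2 (.exGE n p ψ) fun q hq => (hψ hq.1).resolve_left hq.2
  refine ⟨e, fun a => ⟨fun q => ?_, fun φ hφ => ?_⟩⟩
  · by_cases hq : q = p
    · subst hq
      simp [Position.put]
    · simp only [Position.put, Function.update_of_ne hq]
      exact hx.1 q
  · have hD : φ.freeVars ⊆ D := fun q hq => by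
      by_cases hqp : q = p
      · exact Or.inl hqp
      · have := hφ q hq
        simp only [Position.put] at this
        rw [Function.update_of_ne hqp] at this
        exact Or.inr this
    exact (Set.ext_iff.mp (he a) ⟨φ, hD⟩).symm

theorem isBijectiveSystem_countingPositions [Finite A] [Finite B] (h : CountingEquiv k A B) :
    IsBijectiveSystem (countingPositions k A B) where
  start_mem := ⟨fun _ => iff_of_true rfl rfl, fun φ hfv =>
    h φ (Set.eq_empty_of_forall_notMem fun p hp => hfv p hp rfl)⟩
  preservesRel x hx n R y a ha hR :=
    (hx.2 (.rel R y) (by rintro _ ⟨i, rfl⟩; simp [ha i])).mp ⟨a, ha, hR⟩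
  preservesEq x hx p q a hp hq :=
    (hx.2 (.eq p q) (by rintro r (rfl | rfl) <;> simp [*])).mp ⟨a, hp, hq⟩
  preservesRel_swap x hx n R y b hb hR :=
    (hx.2 (.rel R y) (by
      rintro _ ⟨i, rfl⟩
      rw [Ne, hx.1, ← Prod.fst_swap, hb i]
      simp)).mpr ⟨b, hb, hR⟩
  preservesEq_swap x hx p q b hp hq :=
    (hx.2 (.eq p q) (by
      rintro r (rfl | rfl) <;> rw [Ne, hx.1, ← Prod.fst_swap] <;> simp [*])).mpr ⟨b, hp, hq⟩
  bij := exists_equiv_put_mem_countingPositions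

theorem IsBijectiveSystem.swap {S : Set (Position k A B)} (hS : IsBijectiveSystem S) :
    IsBijectiveSystem (A := B) (B := A) (Prod.swap ⁻¹' S) where
  start_mem := hS.start_mem
  preservesRel x hx := hS.preservesRel_swap _ hx
  preservesEq x hx := hS.preservesEq_swap _ hx
  preservesRel_swap x hx := hS.preservesRel _ hx
  preservesEq_swap x hx := hS.preservesEq _ hx
  bij x hx p := by
    obtain ⟨e, he⟩ := hS.bij _ hx p
    refine ⟨e.symm, fun b => ?_⟩
    have := he (e.symm b)
    rwa [e.apply_symm_apply] at this

end Bijective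

/-! ### Strategies that undo one another -/

namespace Plays

variable {k : ℕ} {A B : Type u}

theorem coext_concat (f : Plays k A → B) (l : List (Fin k × A)) (m : Fin k × A)
    (h : l ++ [m] ≠ []) :
    coext f ⟨l ++ [m], h⟩ = ⟨coextList f l ++ [(m.1, f ⟨l ++ [m], h⟩)], by simp⟩ :=
  Subtype.ext (by rw [coe_coext, coextList_concat])

theorem coextList_coextList {f : Plays k A → B} {g : Plays k B → A}
    (h : ∀ s, g (coext f s) = s.counit) (l : List (Fin k × A)) :
    coextList g (coextList f l) = l := by
  induction l using List.reverseRecOn with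
  | nil => rfl
  | append_singleton l m ih =>
    have := h ⟨l ++ [m], by simp⟩
    rw [coext_concat] at this
    rw [coextList_concat, coextList_concat, ih, this]
    simp [counit, lastMove]

/-- If `f` and `g` undo one another, then the replies of `f` to the moves of the pebble `p` after
`l` form a bijection. -/
def extensionEquiv {f : Plays k A → B} {g : Plays k B → A} (hfg : ∀ s, g (coext f s) = s.counit)
    (hgf : ∀ s, f (coext g s) = s.counit) (l : List (Fin k × A)) (p : Fin k) : A ≃ B where
  toFun a := f ⟨l ++ [(p, a)], by simp⟩
  invFun b := g ⟨coextList f l ++ [(p, b)], by simp⟩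
  left_inv a := by
    have := hfg ⟨l ++ [(p, a)], by simp⟩
    rw [coext_concat] at this
    simpa [counit, lastMove] using this
  right_inv b := by
    have := hgf ⟨coextList f l ++ [(p, b)], by simp⟩
    -- Coextending the history back along `g` returns `l`, so `f` is evaluated after the original
    -- history.
    simp only [coext_concat, coextList_coextList hfg] at this
    simpa [counit, lastMove] using this

end Plays

section BijectiveStrategies

variable {k : ℕ} {A B : Type u}

/-- The strategy inverse to a strategy that replies by bijections. -/
def Position.swapStrategy (e : Position k A B → Fin k → A ≃ B) : Position k B A → Fin k → B ≃ A :=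
  fun x p => (e x.swap p).symm

/-- The mirrored play visits the swapped positions, so at each move the inverse strategy inverts the
very bijection that was used. -/
theorem Position.run_swapStrategy (e : Position k A B → Fin k → A ≃ B) (l : List (Fin k × A)) :
    Position.run (fun x p => Position.swapStrategy e x p)
      (Plays.coextList (Position.lastReply fun x p => e x p) l) =
      (Position.run (fun x p => e x p) l).swap := by
  induction l using List.reverseRecOn with
  | nil => rfl
  | append_singleton l m ih =>
    rw [Plays.coextList_concat, Position.run_concat, ih, Position.lastReply_concat,
      Position.run_concat]
    simp [Position.swapStrategy, Position.put]

theorem Position.lastReply_swapStrategy_coext (e : Position k A B → Fin k → A ≃ B)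
    (s : Plays k A) :
    Position.lastReply (fun x p => Position.swapStrategy e x p)
      (Plays.coext (Position.lastReply fun x p => e x p) s) = s.counit := by
  obtain ⟨l, hl⟩ := s
  obtain ⟨l, m, rfl⟩ := (List.eq_nil_or_concat' l).resolve_left hl
  rw [Plays.coext_concat, Position.lastReply_concat, Position.run_swapStrategy, Position.lastReply_concat]
  simp [Position.swapStrategy, Plays.counit, Plays.lastMove]

end BijectiveStrategies

/-! ### CoKleisli isomorphisms and bijective systems -/

section Isomorphisms

variable {σ : FirstOrder.Language.{u, u}} [σ.IsRelational] {k : ℕ} {A B : RelStr σ}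

/-- Composition is defined through `δ = id^*` and `P_k f = (f ∘ ε)^*`; the Kleisli laws collapse
these to `f^*`. -/
theorem fn_comp_cokleisli {A B C : PebbleKl σ k} (f : A ⟶ B) (g : B ⟶ C) :
    RelStr.fn (A := pebbleObj σ k A.of) (B := C.of) (f ≫ g).of =
      RelStr.fn (A := pebbleObj σ k B.of) (B := C.of) g.of ∘
        Plays.coext (RelStr.fn (A := pebbleObj σ k A.of) (B := B.of) f.of) := by
  have h : (f ≫ g).of = pebbleCoext f.of ≫ g.of := by
    change pebbleCoext (𝟙 _) ≫ pebbleCoext (pebbleCounit _ ≫ f.of) ≫ g.of = _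
    exact (Category.assoc _ _ _).symm.trans (congrArg (· ≫ g.of) ((pebbleCoext_comp _ _).symm.trans
      (congrArg pebbleCoext ((Category.assoc _ _ _).symm.trans
        ((congrArg (· ≫ f.of) (pebbleCoext_comp_counit _)).trans (Category.id_comp _))))))
  rw [h]
  rfl

/-- Two strategies over `σ⁺` that undo one another form an isomorphism. -/
def klPlusIso (f : pebbleObj (plusLanguage σ) k (plusObj A) ⟶ plusObj B)
    (g : pebbleObj (plusLanguage σ) k (plusObj B) ⟶ plusObj A)
    (hfg : ∀ s : Plays k A, RelStr.fn g (Plays.coext (RelStr.fn f) s) = s.counit)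
    (hgf : ∀ s : Plays k B, RelStr.fn f (Plays.coext (RelStr.fn g) s) = s.counit) :
    toKlPlus k A ≅ toKlPlus k B where
  hom := ⟨⟨f⟩⟩
  inv := ⟨⟨g⟩⟩
  hom_inv_id := InducedCategory.hom_ext <| Cokleisli.hom_ext _ <| RelStr.fn_inj <|
    (fn_comp_cokleisli (A := toKl k (plusObj A)) (B := toKl k (plusObj B))
      (C := toKl k (plusObj A)) ⟨f⟩ ⟨g⟩).trans (funext hfg)
  inv_hom_id := InducedCategory.hom_ext <| Cokleisli.hom_ext _ <| RelStr.fn_inj <|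
    (fn_comp_cokleisli (A := toKl k (plusObj B)) (B := toKl k (plusObj A))
      (C := toKl k (plusObj B)) ⟨g⟩ ⟨f⟩).trans (funext hgf)

theorem fn_inv_coext_hom (i : toKlPlus k A ≅ toKlPlus k B) (s : Plays k A) :
    RelStr.fn (A := pebbleObj (plusLanguage σ) k (plusObj B)) (B := plusObj A) i.inv.hom.of
      (Plays.coext (RelStr.fn (A := pebbleObj (plusLanguage σ) k (plusObj A)) (B := plusObj B)
        i.hom.hom.of) s) = s.counit := by
  have h := congrArg (fun j => j.hom) i.hom_inv_id
  have h2 := congrFun ((fn_comp_cokleisli i.hom.hom i.inv.hom).symm.trans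
    (congrArg (fun j => RelStr.fn (A := pebbleObj (plusLanguage σ) k (plusObj A))
      (B := plusObj A) j.of) h)) s
  exact h2

theorem IsBijectiveSystem.preservesRel_run {S : Set (Position k A B)} (hS : IsBijectiveSystem S)
    (e : Position k A B → Fin k → A ≃ B) (he : ∀ x ∈ S, ∀ p a, x.put p a (e x p a) ∈ S)
    (l : List (Fin k × A)) : Position.PreservesRel (A := plusObj A) (B := plusObj B)
      (plusLanguage σ) (Position.ofPlay (Position.lastReply fun x p => e x p) l) := by
  have hl := Position.run_mem hS.start_mem (fun x p => e x p) he l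
  rw [← Position.ofPlay_lastReply] at hl
  exact (preservesRel_plus_iff _).mpr ⟨hS.preservesRel _ hl, hS.preservesEq _ hl⟩

theorem IsBijectiveSystem.nonempty_iso {S : Set (Position k A B)} (hS : IsBijectiveSystem S) :
    Nonempty (toKlPlus k A ≅ toKlPlus k B) := by
  have : ∀ (x : Position k A B) (p : Fin k), ∃ e : A ≃ B, x ∈ S → ∀ a, x.put p a (e a) ∈ S := by
    intro x p
    by_cases hx : x ∈ S
    · obtain ⟨e, he⟩ := hS.bij x hx p
      exact ⟨e, fun _ => he⟩
    · obtain ⟨e, -⟩ := hS.bij _ hS.start_mem p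
      exact ⟨e, fun h => absurd h hx⟩
  choose e he using this
  have he' : ∀ x ∈ Prod.swap ⁻¹' S, ∀ p b,
      Position.put x p b (Position.swapStrategy e x p b) ∈ Prod.swap ⁻¹' S := by
    intro x hx p b
    have := he _ p hx ((e x.swap p).symm b)
    rwa [Equiv.apply_symm_apply] at this
  exact ⟨klPlusIso
    (homOfPreservesRel (A := plusObj A) (B := plusObj B) (Position.lastReply fun x p => e x p)
      (hS.preservesRel_run e fun x hx p => he x p hx))
    (homOfPreservesRel (A := plusObj B) (B := plusObj A)
      (Position.lastReply fun x p => Position.swapStrategy e x p)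
      (hS.swap.preservesRel_run (Position.swapStrategy e) he'))
    (Position.lastReply_swapStrategy_coext e)
    -- Swapping twice gives back `e`, so the same one-sided identity yields the other composite.
    (Position.lastReply_swapStrategy_coext (Position.swapStrategy e))⟩

/-- The positions that arise when the second player follows an isomorphism. -/
theorem isBijectiveSystem_range_ofPlay (f : pebbleObj (plusLanguage σ) k (plusObj A) ⟶ plusObj B)
    (g : pebbleObj (plusLanguage σ) k (plusObj B) ⟶ plusObj A)
    (hfg : ∀ s : Plays k A, RelStr.fn g (Plays.coext (RelStr.fn f) s) = s.counit)
    (hgf : ∀ s : Plays k B, RelStr.fn f (Plays.coext (RelStr.fn g) s) = s.counit) :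
    IsBijectiveSystem (A := A) (B := B)
      (Set.range (Position.ofPlay (A := A) (B := B) (RelStr.fn f))) := by
  -- As `g` undoes `f`, the swapped positions are reached by `g` on mirrored plays; preservation
  -- from `B` to `A` then comes from `g` being a homomorphism.
  have hswap : ∀ l : List (Fin k × A), (Position.ofPlay (B := B) (RelStr.fn f) l).swap =
      Position.ofPlay (A := B) (B := A) (RelStr.fn g)
        (Plays.coextList (B := B) (RelStr.fn f) l) := fun l =>
    congrArg (fun l' => (Plays.board (Plays.coextList (B := B) (RelStr.fn f) l), Plays.board l'))
      (Plays.coextList_coextList hfg l).symm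
  have hpres : ∀ l, _ ∧ _ := fun l => (preservesRel_plus_iff _).mp (preservesRel_ofPlay f l)
  have hpres' : ∀ l, _ ∧ _ := fun l => (preservesRel_plus_iff _).mp (preservesRel_ofPlay g l)
  refine ⟨⟨[], rfl⟩, ?_, ?_, ?_, ?_, ?_⟩
  · rintro _ ⟨l, rfl⟩
    exact (hpres l).1
  · rintro _ ⟨l, rfl⟩
    exact (hpres l).2
  · rintro _ ⟨l, rfl⟩
    exact hswap l ▸ (hpres' _).1
  · rintro _ ⟨l, rfl⟩
    exact hswap l ▸ (hpres' _).2
  · rintro _ ⟨l, rfl⟩ p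
    refine ⟨Plays.extensionEquiv hfg hgf l p, fun a => ⟨l ++ [(p, a)], ?_⟩⟩
    exact Position.ofPlay_concat ..

theorem nonempty_klPlusIso_iff :
    Nonempty (toKlPlus k A ≅ toKlPlus k B) ↔ ∃ S : Set (Position k A B), IsBijectiveSystem S :=
  ⟨fun ⟨i⟩ => ⟨_, isBijectiveSystem_range_ofPlay i.hom.hom.of i.inv.hom.of
    (fn_inv_coext_hom i) (fn_inv_coext_hom i.symm)⟩, fun ⟨_, hS⟩ => hS.nonempty_iso⟩

end Isomorphisms

theorem mainTheorem2 (σ : FirstOrder.Language.{u, u}) [σ.IsRelational] (hσ : IsEmpty (σ.Relations 0))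
    (k : ℕ) (hk : 0 < k) :
    (∀ A B : RelStr σ,
      (ExPosEquiv k A B ↔ Nonempty (toKl k A ⟶ toKl k B) ∧ Nonempty (toKl k B ⟶ toKl k A)) ∧
      (ExPosEquiv k A B ↔
        Nonempty (toKlPlus k A ⟶ toKlPlus k B) ∧ Nonempty (toKlPlus k B ⟶ toKlPlus k A))) ∧
    (∀ A B : RelStr σ, Finite A → Finite B →
      (CountingEquiv k A B ↔ Nonempty (toKlPlus k A ≅ toKlPlus k B))) := by
  refine ⟨fun A B => ⟨?_, ?_⟩, fun A B _ _ => ⟨fun h => ?_, fun h φ _ => ?_⟩⟩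
  · rw [exPosEquiv_iff]
    exact and_congr ((exPos_preserved_tfae k A B).out 0 2) ((exPos_preserved_tfae k B A).out 0 2)
  · rw [exPosEquiv_iff]
    exact and_congr ((exPos_preserved_tfae k A B).out 0 1) ((exPos_preserved_tfae k B A).out 0 1)
  · exact (isBijectiveSystem_countingPositions h).nonempty_iso
  · obtain ⟨S, hS⟩ := nonempty_klPlusIso_iff.mp h
    exact hS.sat_iff φ _ hS.start_mem
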